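/- **Conventions.** Directed sets are nonempty. A dcpo is a partially ordered set in which every directed subset has a supremum (a least element is not required). For a dcpo $L$, $\Sigma L$ denotes $L$ with the Scott topology. A topological space $X$ carries its specialization order, $x\sqsubseteq y \iff x\in\overline{\{y\}}$, and $\uparrow F$ denotes the upper set generated by $F$ in this order. For a directed set $D\subseteq X$ write $D\to x$ (and $x\in\lim D$) if $D$ meets every open neighbourhood of $x$. $X$ is a *directed space* if it is $T_0$ and a set $U\subseteq X$ is open whenever $D\cap U\neq\emptyset$ for every directed $D$ and every $x\in U$ with $D\to x$. **Algebras.** A *deflationary directed semilattice* (respectively, *deflationary dcpo-semilattice*) is a directed space with a separately continuous (respectively, a dcpo with a Scott continuous) binary operation $\wedge$ that is commutative, associative, idempotent and satisfies $x\wedge y\leq x$. The *directed upper powerspace* of a directed space $X$ is the free deflationary directed semilattice over $X$: it has a continuous map from $X$ through which every continuous map from $X$ to a deflationary directed semilattice factors by a unique continuous homomorphism. The *upper (Smyth) powerdomain* of a dcpo $L$ is the free deflationary dcpo-semilattice over $L$: it has a Scott continuous map from $L$ through which every Scott continuous map from $L$ to a deflationary dcpo-semilattice factors by a unique Scott continuous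 homomorphism. **The space $\mathcal U X$.** For a directed space $X$ let $UX=\{\uparrow F: F\subseteq X \text{ finite, nonempty}\}$, ordered by reverse inclusion. For a directed family $\mathcal F\subseteq UX$ and $\uparrow F\in UX$ write $\mathcal F\Rightarrow_U\,\uparrow F$ if there are finitely many directed sets $D_1,\dots,D_n\subseteq X$ such that $F\cap\lim D_i\neq\emptyset$ for all $i$, $F\subseteq\bigcup_i\lim D_i$, and for every $(d_1,\dots,d_n)\in\prod_i D_i$ some $\uparrow F'\in\mathcal F$ satisfies $\uparrow F'\subseteq\bigcup_i\uparrow d_i$. A set $\mathcal V\subseteq UX$ is open if $\mathcal F\Rightarrow_U\,\uparrow F\in\mathcal V$ implies $\mathcal F\cap\mathcal V\neq\emptyset$ for every directed $\mathcal F$. Let $\mathcal U X$ be $UX$ with this topology; for a dcpo $L$ put $\mathcal U L=\mathcal U(\Sigma L)$. **D-completion.** For a $T_0$ space $X$ let $\Gamma(X)$ be the set of nonempty closed subsets of $X$ ordered by inclusion, and let $\widetilde X\subseteq\Gamma(X)$ be the smallest subset that contains $\downarrow x=\overline{\{x\}}$ for all $x\in X$ and is closed under existing suprema (in $\Gamma(X)$)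 of directed subsets. The D-completion of $X$ is $\widetilde X$ with the topology generated by the sets $\Diamond O=\{A\in\widetilde X: A\cap O\neq\emptyset\}$, $O\subseteq X$ open, and with the map $\xi(x)=\downarrow x$. **Proposition.** Let $L$ be an arbitrary dcpo. 1. $\mathcal U L$, with the operation $\cup$ and the map $x\mapsto\uparrow x$, is the directed upper powerspace of $\Sigma L$. 2. The topology of the D-completion of $\mathcal U L$ is the Scott topology of $\widetilde{\mathcal U L}$ (ordered by inclusion). 3. $\widetilde{\mathcal U L}$ is the upper powerdomain of $L$ up to isomorphism. That is, $A\wedge B=\overline{\{a\cup b: a\in A,\ b\in B\}}$ (closure in $\mathcal U L$) defines an operation on $\widetilde{\mathcal U L}$; with this operation and the map $x\mapsto\xi(\uparrow x)$, $\widetilde{\mathcal U L}$ is an upper powerdomain of $L$; and for every upper powerdomain $(P,\wedge_P,j)$ of $L$ there is a unique order isomorphism $\widetilde{\mathcal U L}\to P$ that preserves the operation and carries $\xi(\uparrow x)$ to $j(x)$ for all $x\in L$. -/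

import Mathlib

open Set Topology

universe u v w

namespace DirectedPowerspace

/-! ### Dcpos -/

/-- A directed complete poset: every nonempty directed subset has a supremum
(a least element is not required). -/
def IsDcpo (P : Type u) [PartialOrder P] : Prop :=
  ∀ D : Set P, D.Nonempty → DirectedOn (· ≤ ·) D → ∃ a, IsLUB D a

/-- A deflationary dcpo-semilattice: a dcpo with a Scott continuous binary operation which is
commutative, associative, idempotent and deflationary. -/
structure IsDeflationaryDcpoSemilattice (P : Type u) [PartialOrder P] (m : P → P → P) : Prop where
  isDcpo : IsDcpo P
  scottContinuous : ScottContinuous (fun p : P × P => m p.1 p.2)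
  comm : ∀ x y, m x y = m y x
  assoc : ∀ x y z, m (m x y) z = m x (m y z)
  idem : ∀ x, m x x = x
  deflation : ∀ x y, m x y ≤ x

/-- `(P, m)` with the unit `j : L → P` is the upper (Smyth) powerdomain of the dcpo `L`, i.e. the
free deflationary dcpo-semilattice over `L`. -/
structure IsUpperPowerdomain (L : Type u) [PartialOrder L] (P : Type w) [PartialOrder P]
    (m : P → P → P) (j : L → P) : Prop where
  isAlgebra : IsDeflationaryDcpoSemilattice P m
  unit_scottContinuous : ScottContinuous j
  existsUnique_lift : ∀ (Q : Type v) [PartialOrder Q] (n : Q → Q → Q),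
    IsDeflationaryDcpoSemilattice Q n → ∀ f : L → Q, ScottContinuous f →
      ∃! g : P → Q, ScottContinuous g ∧ (∀ a b, g (m a b) = n (g a) (g b)) ∧ ∀ x, g (j x) = f x

/-! ### Directed spaces -/

section Spaces

variable (X : Type u) [TopologicalSpace X]

variable {X} in
/-- The specialization order `x ⊑ y ↔ x ∈ closure {y}`. -/
def SpecLE (x y : X) : Prop := x ∈ closure {y}

variable {X} in
/-- Nonempty subsets directed in the specialization order. -/
def IsDirectedSet (D : Set X) : Prop := D.Nonempty ∧ DirectedOn SpecLE D

variable {X} in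
/-- The limits of a directed set `D`, seen as a monotone net: `D → x` iff `D` meets every open
neighbourhood of `x`. -/
def dirLim (D : Set X) : Set X := {x | ∀ U : Set X, IsOpen U → x ∈ U → (D ∩ U).Nonempty}

/-- A directed space: a `T₀` space in which every directed-open set is open. -/
structure IsDirectedSpace : Prop where
  t0 : T0Space X
  isOpen_of_directedOpen : ∀ U : Set X,
    (∀ D : Set X, IsDirectedSet D → ∀ x ∈ dirLim D, x ∈ U → (D ∩ U).Nonempty) → IsOpen U

/-- A deflationary directed semilattice: a directed space with a separately continuous binary
operation which is commutative, associative, idempotent and deflationary. -/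
structure IsDeflationaryDirectedSemilattice (m : X → X → X) : Prop where
  isDirectedSpace : IsDirectedSpace X
  continuous_left : ∀ y, Continuous (fun x => m x y)
  continuous_right : ∀ x, Continuous (fun y => m x y)
  comm : ∀ x y, m x y = m y x
  assoc : ∀ x y z, m (m x y) z = m x (m y z)
  idem : ∀ x, m x x = x
  deflation : ∀ x y, SpecLE (m x y) x

/-- `(A, m)` with the unit `i : X → A` is the directed upper powerspace of the directed space `X`,
i.e. the free deflationary directed semilattice over `X`. -/
structure IsDirectedUpperPowerspace (A : Type w) [TopologicalSpace A]
    (m : A → A → A) (i : X → A) : Prop where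
  isAlgebra : IsDeflationaryDirectedSemilattice A m
  unit_continuous : Continuous i
  existsUnique_lift : ∀ (B : Type v) [TopologicalSpace B] (n : B → B → B),
    IsDeflationaryDirectedSemilattice B n → ∀ f : X → B, Continuous f →
      ∃! g : A → B, Continuous g ∧ (∀ a b, g (m a b) = n (g a) (g b)) ∧ ∀ x, g (i x) = f x

end Spaces

/-! ### Finitely generated upper sets with the `⇒_U` convergence topology -/

section UpperSpace

variable {X : Type u} [TopologicalSpace X]

/-- The upper set `↑F` generated by `F` in the specialization order. -/
def specUp (F : Set X) : Set X := {y | ∃ x ∈ F, SpecLE x y}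

variable (X) in
/-- `UX`: the sets `↑F` for `F` a nonempty finite subset of `X`. -/
def UpperSpace : Type u := {A : Set X // ∃ F : Set X, F.Finite ∧ F.Nonempty ∧ specUp F = A}

/-- The underlying subset of `X`. -/
def UpperSpace.carrier (A : UpperSpace X) : Set X := A.1

/-- The order `≤_U`: reverse inclusion. -/
instance : PartialOrder (UpperSpace X) where
  le A B := B.carrier ⊆ A.carrier
  le_refl _ := subset_rfl
  le_trans _ _ _ h₁ h₂ := h₂.trans h₁
  le_antisymm _ _ h₁ h₂ := Subtype.ext (h₂.antisymm h₁)

/-- The convergence `𝓕 ⇒_U A`, where `A = ↑F` with `F` nonempty and finite. (If the conditions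
hold for one finite `F` generating `A`, then they hold for every such `F`.) -/
def UConverges (𝓕 : Set (UpperSpace X)) (A : UpperSpace X) : Prop :=
  ∃ F : Set X, F.Finite ∧ F.Nonempty ∧ specUp F = A.carrier ∧
    ∃ (n : ℕ) (D : Fin n → Set X), (∀ i, IsDirectedSet (D i)) ∧
      (∀ i, (F ∩ dirLim (D i)).Nonempty) ∧
      (F ⊆ ⋃ i, dirLim (D i)) ∧
      (∀ d : Fin n → X, (∀ i, d i ∈ D i) → ∃ B ∈ 𝓕, B.carrier ⊆ ⋃ i, specUp {d i})

/-- `𝓥 ⊆ UX` is `⇒_U` convergence open. -/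
def IsUConvergenceOpen (𝓥 : Set (UpperSpace X)) : Prop :=
  ∀ 𝓕 : Set (UpperSpace X), 𝓕.Nonempty → DirectedOn (· ≤ ·) 𝓕 →
    ∀ A, UConverges 𝓕 A → A ∈ 𝓥 → (𝓕 ∩ 𝓥).Nonempty

theorem specLE_refl (x : X) : SpecLE x x := subset_closure rfl

theorem specLE_trans {x y z : X} (h₁ : SpecLE x y) (h₂ : SpecLE y z) : SpecLE x z :=
  closure_minimal (singleton_subset_iff.2 h₂) isClosed_closure h₁

theorem uConverges_singleton {A B : UpperSpace X} (h : A ≤ B) : UConverges {B} A := by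
  obtain ⟨F, hF, hne, hA⟩ := A.2
  obtain ⟨n, e, he⟩ := hF.fin_param
  refine ⟨F, hF, hne, hA, n, fun i => {e i}, fun i => ⟨singleton_nonempty _, ?_⟩, fun i => ?_,
    fun x hx => ?_, fun d hd => ⟨B, rfl, fun y hy => ?_⟩⟩
  · rintro a rfl b rfl
    exact ⟨_, rfl, specLE_refl _, specLE_refl _⟩
  · exact ⟨e i, by rw [← he.2]; exact mem_range_self i, fun U _ hx => ⟨e i, rfl, hx⟩⟩
  · rw [← he.2] at hx
    obtain ⟨i, rfl⟩ := hx
    exact mem_iUnion.2 ⟨i, fun U _ hx => ⟨e i, rfl, hx⟩⟩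
  · have hy' : y ∈ specUp F := by rw [hA]; exact h hy
    obtain ⟨x, hx, hxy⟩ := hy'
    rw [← he.2] at hx
    obtain ⟨i, rfl⟩ := hx
    exact mem_iUnion.2 ⟨i, e i, (hd i).symm, hxy⟩

theorem IsUConvergenceOpen.mem_of_le {𝓥 : Set (UpperSpace X)} (h : IsUConvergenceOpen 𝓥)
    {A B : UpperSpace X} (hA : A ∈ 𝓥) (hAB : A ≤ B) : B ∈ 𝓥 := by
  obtain ⟨C, hC, hC'⟩ := h {B} (singleton_nonempty _)
    (by rintro a rfl b rfl; exact ⟨_, rfl, le_rfl, le_rfl⟩) A (uConverges_singleton hAB) hA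
  obtain rfl : C = B := hC
  exact hC'

/-- The topology of `⇒_U` convergence open sets. -/
instance : TopologicalSpace (UpperSpace X) where
  IsOpen := IsUConvergenceOpen
  isOpen_univ 𝓕 hne _ _ _ _ := by simpa using hne
  isOpen_inter 𝓥 𝓦 h₁ h₂ 𝓕 hne hdir A hA hmem := by
    obtain ⟨B, hB, hBV⟩ := h₁ 𝓕 hne hdir A hA hmem.1
    obtain ⟨C, hC, hCW⟩ := h₂ 𝓕 hne hdir A hA hmem.2
    obtain ⟨E, hE, hBE, hCE⟩ := hdir B hB C hC
    exact ⟨E, hE, h₁.mem_of_le hBV hBE, h₂.mem_of_le hCW hCE⟩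
  isOpen_sUnion S h 𝓕 hne hdir A hA hmem := by
    obtain ⟨𝓥, hV, hAV⟩ := hmem
    obtain ⟨B, hB, hBV⟩ := h 𝓥 hV 𝓕 hne hdir A hA hAV
    exact ⟨B, hB, 𝓥, hV, hBV⟩

theorem specUp_union (F G : Set X) : specUp (F ∪ G) = specUp F ∪ specUp G := by
  ext y; simp [specUp, or_and_right, exists_or]

/-- The operation on `UX`: the union `↑F ∪ ↑G = ↑(F ∪ G)`. -/
def UpperSpace.union (A B : UpperSpace X) : UpperSpace X :=
  ⟨A.carrier ∪ B.carrier, by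
    obtain ⟨F, hF, hFne, hA⟩ := A.2
    obtain ⟨G, hG, -, hB⟩ := B.2
    exact ⟨F ∪ G, hF.union hG, hFne.inl, by rw [specUp_union, hA, hB]; rfl⟩⟩

/-- The unit `x ↦ ↑x`. -/
def UpperSpace.unit (x : X) : UpperSpace X :=
  ⟨specUp {x}, {x}, finite_singleton x, singleton_nonempty x, rfl⟩

end UpperSpace

/-! ### The D-completion -/

section Completion

variable (X : Type u) [TopologicalSpace X]

/-- `Γ(X)`: the nonempty closed subsets of `X`, ordered by inclusion. -/
abbrev NonemptyCloseds : Type u := {A : Set X // IsClosed A ∧ A.Nonempty}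

variable {X} in
/-- `x ↦ ↓x`, the closure of the point `x`. -/
def pointClosure (x : X) : NonemptyCloseds X :=
  ⟨closure {x}, isClosed_closure, (singleton_nonempty x).closure⟩

/-- The d-closure of `S`: the least subset containing `S` that is closed under all existing
suprema of nonempty directed subsets. -/
def dClosure {P : Type u} [PartialOrder P] (S : Set P) : Set P :=
  ⋂₀ {C | S ⊆ C ∧ DirSupClosed C}

/-- The D-completion of `X`: the d-closure of `{↓x | x ∈ X}` in `Γ(X)`, ordered by inclusion. -/
abbrev DCompletion : Type u :=
  {A : NonemptyCloseds X // A ∈ dClosure (range (pointClosure : X → NonemptyCloseds X))}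

variable {X} in
/-- The underlying closed subset of `X`. -/
def DCompletion.carrier (A : DCompletion X) : Set X := A.1.1

variable {X} in
/-- The canonical map `ξ : X → X^d`, `x ↦ ↓x`. -/
def DCompletion.xi (x : X) : DCompletion X :=
  ⟨pointClosure x, fun _ hC => hC.1 (mem_range_self x)⟩

/-- The topology of the D-completion, generated by the sets `◇U = {A | A ∩ U ≠ ∅}`, `U` open. -/
abbrev DCompletion.topology : TopologicalSpace (DCompletion X) :=
  TopologicalSpace.generateFrom
    {V | ∃ U : Set X, IsOpen U ∧ V = {A : DCompletion X | (A.carrier ∩ U).Nonempty}}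

end Completion

end DirectedPowerspace

open DirectedPowerspace

/-! The construction has two stages, each free in its own right. In `𝒰X` the specialization order is
reverse inclusion, so the lift of `f` must send `↑F` to the finite meet of `f '' F`, the greatest
lower bound of `f` on `↑F`. Its continuity (`exists_lowerBound_mem`) rests on replacing the limit
points of `⇒_U` by approximants one at a time, for which separate continuity is enough.

Next, the D-completion of a directed space `Y` turns continuous maps from `Y` into a dcpo into Scott
continuous maps, via `h A = sup (g '' A)`. Induction along directed suprema shows that a Scott open
`V` is `◇(ξ⁻¹ V)`, so its topology is the Scott topology (`topology_eq_scott`). The same induction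
extends the operation of `Y` and proves identities and uniqueness on the completion by checking them
on `ξ`.

The stages compose because a deflationary dcpo-semilattice with its Scott topology is a deflationary
directed semilattice: a Scott continuous map is lifted through `𝒰(ΣL)`, then through the completion.
-/

namespace DirectedPowerspace

/-! ### Specialization order and directed limits. -/

section Specialization

variable {X : Type u} [TopologicalSpace X] {Y : Type v} [TopologicalSpace Y]

theorem SpecLE.mem_of_isOpen {x y : X} (h : SpecLE x y) {U : Set X} (hU : IsOpen U) (hx : x ∈ U) :
    y ∈ U := by
  obtain ⟨z, hz, rfl⟩ := mem_closure_iff.1 h U hU hx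
  exact hz

theorem SpecLE.mem_of_isClosed {x y : X} (h : SpecLE x y) {C : Set X} (hC : IsClosed C)
    (hy : y ∈ C) : x ∈ C :=
  closure_minimal (singleton_subset_iff.2 hy) hC h

theorem SpecLE.antisymm [T0Space X] {x y : X} (h₁ : SpecLE x y) (h₂ : SpecLE y x) : x = y :=
  Inseparable.eq ((inseparable_iff_mem_closure).2 ⟨h₁, h₂⟩)

theorem SpecLE.map {f : X → Y} (hf : Continuous f) {x y : X} (h : SpecLE x y) :
    SpecLE (f x) (f y) := by
  have := image_closure_subset_closure_image hf (mem_image_of_mem f h)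
  rwa [image_singleton] at this

theorem mem_dirLim_image {f : X → Y} (hf : Continuous f) {D : Set X} {x : X} (hx : x ∈ dirLim D) :
    f x ∈ dirLim (f '' D) := fun U hU hxU => by
  obtain ⟨d, hd, hdU⟩ := hx _ (hU.preimage hf) hxU
  exact ⟨f d, mem_image_of_mem f hd, hdU⟩

theorem subset_specUp (F : Set X) : F ⊆ specUp F := fun x hx => ⟨x, hx, specLE_refl x⟩

end Specialization

/-! ### The algebra of finitely generated upper sets. -/

section UpperSpace

variable {X : Type u} [TopologicalSpace X]

namespace UpperSpace

theorem carrier_injective : Function.Injective (carrier : UpperSpace X → Set X) :=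
  Subtype.val_injective

theorem mem_carrier_of_specLE (A : UpperSpace X) {x y : X} (hx : x ∈ A.carrier) (h : SpecLE x y) :
    y ∈ A.carrier := by
  obtain ⟨F, -, -, hF⟩ := A.2
  have hF : specUp F = A.carrier := hF
  rw [← hF] at hx ⊢
  obtain ⟨z, hz, hzx⟩ := hx
  exact ⟨z, hz, specLE_trans hzx h⟩

theorem mem_unit {x y : X} : y ∈ (unit x).carrier ↔ SpecLE x y := by
  simp [unit, carrier, specUp]

theorem union_carrier (A B : UpperSpace X) : (A.union B).carrier = A.carrier ∪ B.carrier := rfl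

theorem unit_le_iff {x : X} {A : UpperSpace X} : A ≤ unit x ↔ x ∈ A.carrier :=
  ⟨fun h => h (mem_unit.2 (specLE_refl x)), fun h _ hy => A.mem_carrier_of_specLE h (mem_unit.1 hy)⟩

theorem induction {p : UpperSpace X → Prop} (unit : ∀ x, p (unit x))
    (union : ∀ A B, p A → p B → p (A.union B)) (A : UpperSpace X) : p A := by
  obtain ⟨F, hF, hne, hA⟩ := A.2
  suffices ∀ A : UpperSpace X, specUp F = A.carrier → p A from this A hA
  clear hA A
  induction F, hF using Set.Finite.induction_on with
  | empty => simp at hne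
  | @insert a s _ _ ih =>
    intro A hA
    have hA' : A.carrier = specUp {a} ∪ specUp s := by rw [← hA, insert_eq, specUp_union]
    rcases s.eq_empty_or_nonempty with rfl | hs
    · have : A = UpperSpace.unit a := carrier_injective (by
        rw [hA', ← specUp_union, union_empty]; rfl)
      exact this ▸ unit a
    · let S : UpperSpace X := ⟨specUp s, s, ‹_›, hs, rfl⟩
      have : A = (UpperSpace.unit a).union S := carrier_injective hA'
      exact this ▸ union _ _ (unit a) (ih hs S rfl)

theorem isOpen_iff {V : Set (UpperSpace X)} : IsOpen V ↔ IsUConvergenceOpen V := Iff.rfl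

/-- If `g` lies in `B` but not in the limit `A = ↑F`, the complement of `closure {g}` is a
neighbourhood of every point of `F`. Each `D i` then has an element `d i` not below `g`, so a member
of `𝓕` inside `⋃ i, ↑(d i)` misses `g`. This identifies the specialization order with reverse
inclusion. -/
theorem isClosed_Iic (B : UpperSpace X) : IsClosed (Iic B) := by
  rw [← isOpen_compl_iff, isOpen_iff]
  rintro 𝓕 - - A ⟨F, -, -, hA, n, D, -, hlim, -, hcov⟩ hAB
  by_contra hne
  have h𝓕 : ∀ C ∈ 𝓕, C ≤ B := fun C hC => by
    by_contra hCB
    exact hne ⟨C, hC, hCB⟩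
  refine hAB fun g hg => ?_
  by_contra hgA
  have hex : ∀ i, ∃ d ∈ D i, ¬ SpecLE d g := fun i => by
    obtain ⟨x, hxF, hx⟩ := hlim i
    obtain ⟨d, hd, hdU⟩ := hx (closure {g})ᶜ isClosed_closure.isOpen_compl
      (fun hxg => hgA (hA ▸ ⟨x, hxF, hxg⟩))
    exact ⟨d, hd, hdU⟩
  choose d hd hdg using hex
  obtain ⟨C, hC, hCd⟩ := hcov d hd
  obtain ⟨i, x, rfl, hx⟩ := mem_iUnion.1 (hCd (h𝓕 C hC hg))
  exact hdg i hx

theorem specLE_iff_le {A B : UpperSpace X} : SpecLE A B ↔ A ≤ B := by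
  refine ⟨fun h => h.mem_of_isClosed (isClosed_Iic B) (mem_Iic.2 le_rfl),
    fun h => mem_closure_iff.2 fun V hV hA => ⟨B, ?_, rfl⟩⟩
  exact (isOpen_iff.1 hV).mem_of_le hA h

theorem isDirectedSet_iff {𝓕 : Set (UpperSpace X)} :
    IsDirectedSet 𝓕 ↔ 𝓕.Nonempty ∧ DirectedOn (· ≤ ·) 𝓕 := by
  simp only [IsDirectedSet, DirectedOn, specLE_iff_le]

theorem isDirectedSpace : IsDirectedSpace (UpperSpace X) where
  t0 := (t0Space_iff_inseparable _).2 fun A B h => by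
    rw [inseparable_iff_mem_closure] at h
    exact le_antisymm (specLE_iff_le.1 h.1) (specLE_iff_le.1 h.2)
  -- Every `⇒_U` limit is a topological limit, directly from the definition of the open sets.
  isOpen_of_directedOpen V hV := isOpen_iff.2 fun 𝓕 hne hdir A hA hAV =>
    hV 𝓕 (isDirectedSet_iff.2 ⟨hne, hdir⟩) A (fun _ hW hAW => hW 𝓕 hne hdir A hA hAW) hAV

theorem union_comm (A B : UpperSpace X) : A.union B = B.union A :=
  carrier_injective (Set.union_comm _ _)

theorem union_assoc (A B C : UpperSpace X) : (A.union B).union C = A.union (B.union C) :=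
  carrier_injective (Set.union_assoc _ _ _)

theorem union_self (A : UpperSpace X) : A.union A = A := carrier_injective (Set.union_self _)

theorem union_le_left (A B : UpperSpace X) : A.union B ≤ A := Set.subset_union_left

theorem union_mono {A A' B B' : UpperSpace X} (hA : A ≤ A') (hB : B ≤ B') :
    A.union B ≤ A'.union B' := Set.union_subset_union hA hB

/-- The witnesses for `𝓕 ⇒_U A` are concatenated with those for the constant convergence `{B} ⇒_U
B`. -/
theorem uConverges_union {𝓕 : Set (UpperSpace X)} {A : UpperSpace X} (h : UConverges 𝓕 A)
    (B : UpperSpace X) : UConverges ((fun C => C.union B) '' 𝓕) (A.union B) := by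
  obtain ⟨F, hF, hFne, hA, n, D, hD, hlim, hcov, hd⟩ := h
  obtain ⟨G, hG, hGne, hB, k, E, hE, hlim', hcov', he⟩ := uConverges_singleton (le_refl B)
  refine ⟨F ∪ G, hF.union hG, hFne.inl, by rw [specUp_union, hA, hB, union_carrier], n + k,
    Fin.append D E, fun i => ?_, fun i => ?_, ?_, fun d hdE => ?_⟩
  · refine Fin.addCases (fun i => ?_) (fun i => ?_) i
    · simpa using hD i
    · simpa using hE i
  · refine Fin.addCases (fun i => ?_) (fun i => ?_) i
    · simpa using (hlim i).mono (inter_subset_inter_left _ subset_union_left)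
    · simpa using (hlim' i).mono (inter_subset_inter_left _ subset_union_right)
  · rintro x (hx | hx)
    · obtain ⟨i, hi⟩ := mem_iUnion.1 (hcov hx)
      exact mem_iUnion.2 ⟨Fin.castAdd k i, by simpa using hi⟩
    · obtain ⟨i, hi⟩ := mem_iUnion.1 (hcov' hx)
      exact mem_iUnion.2 ⟨Fin.natAdd n i, by simpa using hi⟩
  · obtain ⟨C, hC, hCd⟩ := hd (fun i => d (Fin.castAdd k i))
      (fun i => by simpa using hdE (Fin.castAdd k i))
    obtain ⟨_, rfl, hBd⟩ := he (fun i => d (Fin.natAdd n i))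
      (fun i => by simpa using hdE (Fin.natAdd n i))
    refine ⟨_, mem_image_of_mem _ hC, union_subset (hCd.trans ?_) (hBd.trans ?_)⟩
    · exact iUnion_subset fun i => subset_iUnion (fun j => specUp {d j}) (Fin.castAdd k i)
    · exact iUnion_subset fun i => subset_iUnion (fun j => specUp {d j}) (Fin.natAdd n i)

theorem continuous_union_right (B : UpperSpace X) : Continuous fun A : UpperSpace X => A.union B :=
  continuous_def.2 fun V hV => isOpen_iff.2 fun 𝓕 hne hdir A hA hAV => by
    obtain ⟨_, ⟨C, hC, rfl⟩, hCV⟩ := isOpen_iff.1 hV _ (hne.image _)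
      (by
        rintro _ ⟨C, hC, rfl⟩ _ ⟨C', hC', rfl⟩
        obtain ⟨E, hE, h₁, h₂⟩ := hdir C hC C' hC'
        exact ⟨_, mem_image_of_mem _ hE, union_mono h₁ le_rfl, union_mono h₂ le_rfl⟩)
      _ (uConverges_union hA B) hAV
    exact ⟨C, hC, hCV⟩

theorem isDeflationaryDirectedSemilattice :
    IsDeflationaryDirectedSemilattice (UpperSpace X) union where
  isDirectedSpace := isDirectedSpace
  continuous_left := continuous_union_right
  continuous_right A := by simpa only [union_comm A] using continuous_union_right A
  comm := union_comm
  assoc := union_assoc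
  idem := union_self
  deflation A B := specLE_iff_le.2 (union_le_left A B)

theorem uConverges_unit {D : Set X} (hD : IsDirectedSet D) {x : X} (hx : x ∈ dirLim D) :
    UConverges (unit '' D) (unit x) :=
  ⟨{x}, finite_singleton x, singleton_nonempty x, rfl, 1, fun _ => D, fun _ => hD,
    fun _ => ⟨x, rfl, hx⟩, fun _ hy => mem_iUnion.2 ⟨0, by rwa [mem_singleton_iff.1 hy]⟩,
    fun d hd => ⟨unit (d 0), mem_image_of_mem _ (hd 0),
      subset_iUnion (fun i => specUp {d i}) 0⟩⟩

theorem unit_le_unit {x y : X} (h : SpecLE x y) : unit x ≤ unit y :=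
  unit_le_iff.2 (mem_unit.2 h)

theorem continuous_unit (hX : IsDirectedSpace X) : Continuous (unit : X → UpperSpace X) :=
  continuous_def.2 fun V hV => hX.isOpen_of_directedOpen _ fun D hD x hx hxV => by
    obtain ⟨_, ⟨d, hd, rfl⟩, hdV⟩ := isOpen_iff.1 hV (unit '' D) (hD.1.image _)
      (by
        rintro _ ⟨a, ha, rfl⟩ _ ⟨b, hb, rfl⟩
        obtain ⟨c, hc, h₁, h₂⟩ := hD.2 a ha b hb
        exact ⟨_, mem_image_of_mem _ hc, unit_le_unit h₁, unit_le_unit h₂⟩)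
      _ (uConverges_unit hD hx) hxV
    exact ⟨d, hd, hdV⟩

end UpperSpace

end UpperSpace

/-! ### Finite meets and freeness of the upper space. -/

namespace IsDeflationaryDirectedSemilattice

variable {B : Type v} [TopologicalSpace B] {n : B → B → B}

theorem deflation_right (h : IsDeflationaryDirectedSemilattice B n) (x y : B) :
    SpecLE (n x y) y := h.comm x y ▸ h.deflation y x

theorem specLE_meet (h : IsDeflationaryDirectedSemilattice B n) {x y z : B} (hx : SpecLE z x)
    (hy : SpecLE z y) : SpecLE z (n x y) := by
  have h₁ : SpecLE (n z z) (n x z) := hx.map (h.continuous_left z)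
  have h₂ : SpecLE (n x z) (n x y) := hy.map (h.continuous_right x)
  have := specLE_trans h₁ h₂
  rwa [h.idem] at this

theorem exists_glb_of_finite (h : IsDeflationaryDirectedSemilattice B n) {S : Set B}
    (hS : S.Finite) (hne : S.Nonempty) :
    ∃ b, ∀ c, SpecLE c b ↔ ∀ s ∈ S, SpecLE c s := by
  induction S, hS using Set.Finite.induction_on with
  | empty => simp at hne
  | @insert a s _ _ ih =>
    rcases s.eq_empty_or_nonempty with rfl | hs
    · exact ⟨a, by simp⟩
    · obtain ⟨b, hb⟩ := ih hs
      refine ⟨n a b, fun c => ⟨fun hc => ?_, fun hc => ?_⟩⟩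
      · rintro x (rfl | hx)
        · exact specLE_trans hc (h.deflation _ _)
        · exact (hb c).1 (specLE_trans hc (h.deflation_right _ _)) x hx
      · exact h.specLE_meet (hc a (mem_insert _ _))
          ((hb c).2 fun x hx => hc x (mem_insert_of_mem _ hx))

/-- Lower bounds of finitely many limits can be moved to lower bounds of approximants without
leaving an open set. -/
theorem exists_lowerBound_mem (h : IsDeflationaryDirectedSemilattice B n) {V : Set B}
    (hV : IsOpen V) {k : ℕ} (D : Fin k → Set B) (y : Fin k → B) (hy : ∀ i, y i ∈ dirLim (D i))
    (P : B → Prop) (hP : ∀ b c, SpecLE c b → P b → P c)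
    (hb : ∃ b ∈ V, P b ∧ ∀ i, SpecLE b (y i)) :
    ∃ d : Fin k → B, (∀ i, d i ∈ D i) ∧ ∃ b ∈ V, P b ∧ ∀ i, SpecLE b (d i) := by
  induction k generalizing P with
  | zero => exact ⟨y, fun i => i.elim0, hb⟩
  | succ k ih =>
    obtain ⟨b, hbV, hbP, hby⟩ := hb
    -- The bound by `y 0`, not yet treated, is stored in the predicate so that it survives the
    -- induction.
    obtain ⟨d, hd, c, hcV, ⟨hcP, hc0⟩, hcd⟩ := ih (fun i => D i.succ) (fun i => y i.succ)
      (fun i => hy i.succ) (fun b => P b ∧ SpecLE b (y 0))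
      (fun b c hcb hb => ⟨hP b c hcb hb.1, specLE_trans hcb hb.2⟩)
      ⟨b, hbV, ⟨hbP, hby 0⟩, fun i => hby i.succ⟩
    -- Since `c` is below `y 0`, meeting with `y 0` stays in `V`; with `c` fixed, `y 0` can be
    -- replaced by some `e ∈ D 0`.
    have hmem : n (y 0) c ∈ V := (h.specLE_meet hc0 (specLE_refl c)).mem_of_isOpen hV hcV
    obtain ⟨e, he, heV⟩ := hy 0 _ (hV.preimage (h.continuous_left c)) hmem
    refine ⟨Fin.cons e d, Fin.cases he hd, n e c, heV, hP c _ (h.deflation_right e c) hcP,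
      Fin.cases (h.deflation e c) fun i => ?_⟩
    simpa using specLE_trans (h.deflation_right e c) (hcd i)

end IsDeflationaryDirectedSemilattice

theorem isDirectedUpperPowerspace_upperSpace {X : Type u} [TopologicalSpace X]
    (hX : IsDirectedSpace X) :
    IsDirectedUpperPowerspace.{u, v, u} X (UpperSpace X) UpperSpace.union UpperSpace.unit where
  isAlgebra := UpperSpace.isDeflationaryDirectedSemilattice
  unit_continuous := UpperSpace.continuous_unit hX
  existsUnique_lift B _ n hB f hf := by
    have := hB.isDirectedSpace.t0
    -- Bounding `f` on all of `A` makes the value independent of the finite generating set.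
    have hglb : ∀ A : UpperSpace X, ∃ b, ∀ c, SpecLE c b ↔ ∀ x ∈ A.carrier, SpecLE c (f x) := by
      intro A
      obtain ⟨F, hF, hne, hA⟩ := A.2
      have hA : specUp F = A.carrier := hA
      obtain ⟨b, hb⟩ := hB.exists_glb_of_finite (hF.image f) (hne.image f)
      refine ⟨b, fun c => (hb c).trans ⟨fun h x hx => ?_, fun h => ?_⟩⟩
      · rw [← hA] at hx
        obtain ⟨z, hz, hzx⟩ := hx
        exact specLE_trans (h _ (mem_image_of_mem f hz)) (hzx.map hf)
      · rintro _ ⟨x, hx, rfl⟩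
        exact h x (hA ▸ subset_specUp F hx)
    choose g hg using hglb
    have g_unit : ∀ x, g (UpperSpace.unit x) = f x := fun x =>
      SpecLE.antisymm ((hg _ _).1 (specLE_refl _) x (UpperSpace.mem_unit.2 (specLE_refl x)))
        ((hg _ _).2 fun y hy => (UpperSpace.mem_unit.1 hy).map hf)
    have g_union : ∀ A A', g (A.union A') = n (g A) (g A') := fun A A' => by
      refine SpecLE.antisymm (hB.specLE_meet ?_ ?_) ((hg _ _).2 ?_)
      · exact (hg _ _).2 fun x hx => (hg _ _).1 (specLE_refl _) x (Or.inl hx)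
      · exact (hg _ _).2 fun x hx => (hg _ _).1 (specLE_refl _) x (Or.inr hx)
      · rintro x (hx | hx)
        · exact specLE_trans (hB.deflation _ _) ((hg _ _).1 (specLE_refl _) x hx)
        · exact specLE_trans (hB.deflation_right _ _) ((hg _ _).1 (specLE_refl _) x hx)
    refine ⟨g, ⟨continuous_def.2 fun V hV => UpperSpace.isOpen_iff.2 ?_, g_union, g_unit⟩,
      fun g' hg' => funext fun A => ?_⟩
    · rintro 𝓕 - - A ⟨F, -, -, hA, k, D, hD, hlim, -, hcov⟩ hAV
      choose y hyF hy using hlim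
      obtain ⟨d', hd', b, hbV, -, hb⟩ := hB.exists_lowerBound_mem hV (fun i => f '' D i)
        (fun i => f (y i)) (fun i => mem_dirLim_image hf (hy i)) (fun _ => True)
        (fun _ _ _ _ => trivial)
        ⟨g A, hAV, trivial, fun i =>
          (hg _ _).1 (specLE_refl _) _ (hA ▸ subset_specUp F (hyF i))⟩
      choose d hd hdd' using hd'
      obtain ⟨C, hC, hCd⟩ := hcov d hd
      -- As `C ⊆ ⋃ i, ↑(d i)`, the common lower bound `b ∈ V` of the `f (d i)` lies below `g C`.
      refine ⟨C, hC, SpecLE.mem_of_isOpen ((hg C b).2 fun x hx => ?_) hV hbV⟩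
      obtain ⟨i, z, rfl, hzx⟩ := mem_iUnion.1 (hCd hx)
      exact specLE_trans (hdd' i ▸ hb i) (hzx.map hf)
    · induction A using UpperSpace.induction with
      | unit x => rw [hg'.2.2, g_unit]
      | union A A' h h' => rw [hg'.2.1, g_union, h, h']

/-! ### Closures of images and unions under separately continuous operations. -/

section Closure

variable {Y : Type u} [TopologicalSpace Y] {n : Y → Y → Y}

theorem closure_image2_closure_left (hn : ∀ y, Continuous fun x => n x y) (S T : Set Y) :
    closure (image2 n (closure S) T) = closure (image2 n S T) := by
  refine Subset.antisymm (closure_minimal ?_ isClosed_closure)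
    (closure_mono (image2_subset_right subset_closure))
  rintro _ ⟨x, hx, y, hy, rfl⟩
  exact closure_mono (image_subset_image2_left hy)
    (image_closure_subset_closure_image (hn y) (mem_image_of_mem (n · y) hx))

theorem closure_image2_closure_right (hn : ∀ x, Continuous (n x)) (S T : Set Y) :
    closure (image2 n S (closure T)) = closure (image2 n S T) := by
  rw [image2_swap n, image2_swap n]
  exact closure_image2_closure_left (n := fun a b => n b a) hn T S

theorem closure_biUnion_closure {ι : Type*} (S : Set ι) (f : ι → Set Y) :
    closure (⋃ i ∈ S, closure (f i)) = closure (⋃ i ∈ S, f i) :=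
  Subset.antisymm
    (closure_minimal (iUnion₂_subset fun _ hi => closure_mono (subset_biUnion_of_mem hi))
      isClosed_closure)
    (closure_mono (iUnion₂_mono fun _ _ => subset_closure))

end Closure

theorem NonemptyCloseds.isLUB_iff {Y : Type u} [TopologicalSpace Y] {S : Set (NonemptyCloseds Y)}
    (hS : S.Nonempty) {A : NonemptyCloseds Y} : IsLUB S A ↔ A.1 = closure (⋃ B ∈ S, B.1) := by
  obtain ⟨B₀, hB₀⟩ := hS
  let C : NonemptyCloseds Y := ⟨closure (⋃ B ∈ S, B.1), isClosed_closure,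
    (B₀.2.2.mono (subset_biUnion_of_mem (u := fun B : NonemptyCloseds Y => B.1) hB₀)).closure⟩
  have hC : IsLUB S C :=
    ⟨fun B hB => (subset_biUnion_of_mem (u := fun B : NonemptyCloseds Y => B.1) hB).trans
      subset_closure, fun B hB => closure_minimal (iUnion₂_subset fun D hD => hB hD) B.2.1⟩
  exact ⟨fun h => congrArg Subtype.val (h.unique hC), fun h => (Subtype.ext h : A = C) ▸ hC⟩

theorem dirSupClosed_dClosure {P : Type u} [PartialOrder P] (S : Set P) :
    DirSupClosed (dClosure S) :=
  DirSupClosed.sInter fun _ hC => hC.2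

theorem isOpen_scott_iff {P : Type u} [Preorder P] {V : Set P} :
    IsOpen[scott P univ] V ↔ IsUpperSet V ∧ DirSupInacc V := by
  let _ : TopologicalSpace P := scott P univ
  have : IsScott P univ := ⟨rfl⟩
  rw [IsScott.isOpen_iff_isUpperSet_and_dirSupInaccOn (D := univ), dirSupInaccOn_univ]

/-! ### Directed suprema, induction and topology in the D-completion. -/

namespace DCompletion

variable {Y : Type u} [TopologicalSpace Y]

theorem carrier_injective : Function.Injective (carrier : DCompletion Y → Set Y) :=
  Subtype.val_injective.comp Subtype.val_injective

theorem isClosed_carrier (A : DCompletion Y) : IsClosed A.carrier := A.1.2.1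

theorem nonempty_carrier (A : DCompletion Y) : A.carrier.Nonempty := A.1.2.2

theorem xi_carrier (y : Y) : (xi y).carrier = closure {y} := rfl

theorem xi_le_iff {y : Y} {A : DCompletion Y} : xi y ≤ A ↔ y ∈ A.carrier :=
  ⟨fun h => h (subset_closure rfl),
    fun h => closure_minimal (singleton_subset_iff.2 h) A.isClosed_carrier⟩

theorem isLUB_of_carrier_eq {S : Set (DCompletion Y)} {A : DCompletion Y}
    (h : A.carrier = closure (⋃ B ∈ S, B.carrier)) : IsLUB S A := by
  refine ⟨fun B hB => ?_, fun B hB => ?_⟩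
  · change B.carrier ⊆ A.carrier
    exact h ▸ (subset_biUnion_of_mem (u := carrier) hB).trans subset_closure
  · change A.carrier ⊆ B.carrier
    exact h ▸ closure_minimal (iUnion₂_subset fun D hD => hB hD) B.isClosed_carrier

/-- The supremum in `Γ(Y)` is the closure of the union, and the d-closure contains it; directed
suprema in the completion are therefore those of `Γ(Y)`. -/
theorem exists_carrier_eq {S : Set (DCompletion Y)} (hne : S.Nonempty)
    (hS : DirectedOn (· ≤ ·) S) :
    ∃ A : DCompletion Y, A.carrier = closure (⋃ B ∈ S, B.carrier) := by
  obtain ⟨B₀, hB₀⟩ := hne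
  let C : NonemptyCloseds Y := ⟨closure (⋃ B ∈ S, B.carrier), isClosed_closure,
    (B₀.nonempty_carrier.mono (subset_biUnion_of_mem (u := carrier) hB₀)).closure⟩
  refine ⟨⟨C, ?_⟩, rfl⟩
  refine dirSupClosed_dClosure _ (d := Subtype.val '' S) ?_ ⟨_, mem_image_of_mem _ hB₀⟩ ?_
    ((NonemptyCloseds.isLUB_iff ⟨_, mem_image_of_mem _ hB₀⟩).2 ?_)
  · rintro _ ⟨B, -, rfl⟩
    exact B.2
  · exact directedOn_image.2 hS
  · rw [biUnion_image]
    rfl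

theorem isLUB_iff {S : Set (DCompletion Y)} (hne : S.Nonempty) (hS : DirectedOn (· ≤ ·) S)
    {A : DCompletion Y} : IsLUB S A ↔ A.carrier = closure (⋃ B ∈ S, B.carrier) := by
  refine ⟨fun h => ?_, isLUB_of_carrier_eq⟩
  obtain ⟨C, hC⟩ := exists_carrier_eq hne hS
  rw [h.unique (isLUB_of_carrier_eq hC), hC]

theorem isDcpo : IsDcpo (DCompletion Y) := fun _ hne hS =>
  (exists_carrier_eq hne hS).imp fun _ => isLUB_of_carrier_eq

theorem induction {p : DCompletion Y → Prop} (xi : ∀ y, p (xi y))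
    (sup : ∀ (S : Set (DCompletion Y)) (A : DCompletion Y), S.Nonempty → DirectedOn (· ≤ ·) S →
      IsLUB S A → (∀ B ∈ S, p B) → p A) (A : DCompletion Y) : p A := by
  -- Minimality of the d-closure applies to subsets of `Γ(Y)`, so membership in the completion is
  -- built into the predicate.
  suffices h : A.1 ∈ {C : NonemptyCloseds Y | ∃ h, p ⟨C, h⟩} from h.2
  refine A.2 _ ⟨?_, fun d hd hne hdir C hC => ?_⟩
  · rintro _ ⟨y, rfl⟩
    exact ⟨_, xi y⟩
  · have hCmem := dirSupClosed_dClosure _ (fun B hB => (hd hB).1) hne hdir hC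
    have himage : Subtype.val '' (Subtype.val ⁻¹' d : Set (DCompletion Y)) = d :=
      Subtype.image_preimage_coe _ _ |>.trans (inter_eq_right.2 fun B hB => (hd hB).1)
    refine ⟨hCmem, sup (Subtype.val ⁻¹' d) ⟨C, hCmem⟩ ?_ ?_ (isLUB_of_carrier_eq ?_)
      fun B hB => (hd hB).2⟩
    · rw [← himage] at hne
      exact hne.of_image
    · rw [← himage] at hdir
      exact (directedOn_image (f := Subtype.val)).1 hdir
    · refine ((NonemptyCloseds.isLUB_iff hne).1 hC).trans ?_
      conv_lhs => rw [← himage, biUnion_image]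
      rfl

theorem ext_of_scottContinuous {Q : Type v} [PartialOrder Q] {f g : DCompletion Y → Q}
    (hf : ScottContinuous f) (hg : ScottContinuous g) (h : ∀ y, f (xi y) = g (xi y)) : f = g := by
  funext A
  induction A using DCompletion.induction with
  | xi y => exact h y
  | sup S A hne hS hA ih =>
    have := hf hne hS hA
    rw [image_congr ih] at this
    exact this.unique (hg hne hS hA)

theorem topology_eq_scott (hY : IsDirectedSpace Y) :
    topology Y = scott (DCompletion Y) univ := by
  refine le_antisymm ?_ (le_generateFrom ?_)
  · intro V hV
    obtain ⟨hup, hsup⟩ := isOpen_scott_iff.1 hV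
    have hU : IsOpen (xi ⁻¹' V) := hY.isOpen_of_directedOpen _ fun D hD y hy hyV => by
      have hdir : DirectedOn (· ≤ ·) (xi '' D) := by
        rintro _ ⟨a, ha, rfl⟩ _ ⟨b, hb, rfl⟩
        obtain ⟨c, hc, h₁, h₂⟩ := hD.2 a ha b hb
        exact ⟨_, mem_image_of_mem _ hc, xi_le_iff.2 h₁, xi_le_iff.2 h₂⟩
      obtain ⟨C, hC⟩ := exists_carrier_eq (hD.1.image xi) hdir
      -- A limit of `D` lies in the closure of `D`, hence in the supremum of `xi '' D`.
      have hyC : y ∈ C.carrier := by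
        rw [hC, biUnion_image]
        refine closure_mono (fun d hd => ?_) (mem_closure_iff.2 fun U hU hyU => by
          rw [inter_comm]; exact hy U hU hyU)
        exact mem_iUnion₂.2 ⟨d, hd, subset_closure rfl⟩
      obtain ⟨_, ⟨d, hd, rfl⟩, hdV⟩ := hsup (hD.1.image xi) hdir (isLUB_of_carrier_eq hC)
        (hup (xi_le_iff.2 hyC) hyV)
      exact ⟨d, hd, hdV⟩
    -- The claim is `V = ◇(ξ⁻¹ V)`. One inclusion is by induction, `V` being inaccessible by
    -- directed suprema; the other holds because `V` is an upper set.
    refine TopologicalSpace.GenerateOpen.basic _ ⟨_, hU, Subset.antisymm (fun A => ?_) ?_⟩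
    · induction A using DCompletion.induction with
      | xi y => exact fun h => ⟨y, subset_closure rfl, h⟩
      | sup S A hne hS hA ih =>
        intro hAV
        obtain ⟨B, hB, hBV⟩ := hsup hne hS hA hAV
        exact (ih B hB hBV).mono (inter_subset_inter_left _ (hA.1 hB))
    · rintro A ⟨y, hyA, hyV⟩
      exact hup (xi_le_iff.2 hyA) hyV
  · rintro _ ⟨U, hU, rfl⟩
    refine isOpen_scott_iff.2 ⟨fun A B hAB hA => hA.mono (inter_subset_inter_left _ hAB), ?_⟩
    intro S hne hS A hA hAU
    obtain ⟨y, hyA, hyU⟩ := hAU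
    rw [(isLUB_iff hne hS).1 hA] at hyA
    obtain ⟨z, hzU, hz⟩ := mem_closure_iff.1 hyA U hU hyU
    obtain ⟨B, hB, hzB⟩ := mem_iUnion₂.1 hz
    exact ⟨B, hB, z, hzB, hzU⟩

theorem continuous_xi : @Continuous _ _ _ (topology Y) (xi : Y → DCompletion Y) := by
  refine continuous_generateFrom_iff.2 ?_
  rintro _ ⟨U, hU, rfl⟩
  convert hU using 1
  ext y
  refine ⟨fun ⟨z, hz, hzU⟩ => SpecLE.mem_of_isOpen hz hU hzU, fun hy => ⟨y, subset_closure rfl, hy⟩⟩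

theorem closure_image_mem {f : Y → Y} (hf : Continuous f) (A : DCompletion Y) :
    ∃ B : DCompletion Y, B.carrier = closure (f '' A.carrier) := by
  induction A using DCompletion.induction with
  | xi y => exact ⟨xi (f y), by rw [xi_carrier, xi_carrier, closure_image_closure hf,
      image_singleton]⟩
  | sup S A hne hS hA ih =>
    choose! F hF using ih
    have hmono : ∀ B ∈ S, ∀ C ∈ S, B ≤ C → F B ≤ F C := fun B hB C hC h => by
      change (F B).carrier ⊆ (F C).carrier
      rw [hF B hB, hF C hC]
      exact closure_mono (image_mono h)
    obtain ⟨C, hC⟩ := exists_carrier_eq (hne.image F) (by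
      rintro _ ⟨B, hB, rfl⟩ _ ⟨C, hC, rfl⟩
      obtain ⟨E, hE, h₁, h₂⟩ := hS B hB C hC
      exact ⟨_, mem_image_of_mem F hE, hmono _ hB _ hE h₁, hmono _ hC _ hE h₂⟩)
    refine ⟨C, ?_⟩
    rw [hC, (isLUB_iff hne hS).1 hA, closure_image_closure hf, biUnion_image, image_iUnion₂,
      iUnion₂_congr hF, closure_biUnion_closure]

/-- Induction on `B` reduces to a point, where the operation is a continuous self-map of `Y`;
`closure_image_mem` handles that case by induction on `A`. -/
theorem exists_carrier_eq_closure_image2 {n : Y → Y → Y} (hl : ∀ y, Continuous fun x => n x y)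
    (hr : ∀ x, Continuous (n x)) (A B : DCompletion Y) :
    ∃ C : DCompletion Y, C.carrier = closure (image2 n A.carrier B.carrier) := by
  induction B using DCompletion.induction with
  | xi y =>
    rw [xi_carrier, closure_image2_closure_right hr, image2_singleton_right]
    exact closure_image_mem (hl y) A
  | sup S B hne hS hB ih =>
    choose! F hF using ih
    have hmono : ∀ B ∈ S, ∀ C ∈ S, B ≤ C → F B ≤ F C := fun B hB C hC h => by
      change (F B).carrier ⊆ (F C).carrier
      rw [hF B hB, hF C hC]
      exact closure_mono (image2_subset_left h)
    obtain ⟨C, hC⟩ := exists_carrier_eq (hne.image F) (by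
      rintro _ ⟨B, hB, rfl⟩ _ ⟨C, hC, rfl⟩
      obtain ⟨E, hE, h₁, h₂⟩ := hS B hB C hC
      exact ⟨_, mem_image_of_mem F hE, hmono _ hB _ hE h₁, hmono _ hC _ hE h₂⟩)
    refine ⟨C, ?_⟩
    rw [hC, (isLUB_iff hne hS).1 hB, closure_image2_closure_right hr, biUnion_image,
      image2_iUnion₂_right, iUnion₂_congr hF, closure_biUnion_closure]

end DCompletion

/-! ### Scott topologies as directed spaces. -/

theorem isDirectedSpace_of_isScott (Q : Type u) [PartialOrder Q] [TopologicalSpace Q]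
    [IsScott Q univ] : IsDirectedSpace Q where
  t0 := inferInstance
  isOpen_of_directedOpen U hU := by
    have specLE_iff : ∀ x y : Q, SpecLE x y ↔ x ≤ y := fun x y => by
      rw [SpecLE, IsScott.closure_singleton, mem_Iic]
    refine (IsScott.isOpen_iff_isUpperSet_and_dirSupInaccOn (D := univ)).2
      ⟨fun x y hxy hx => ?_, fun D _ hne hdir a ha haU => ?_⟩
    -- The directed set `{y}` converges to every `x ≤ y`, which forces `U` to be an upper set.
    · have hdir : DirectedOn SpecLE ({y} : Set Q) := by
        rintro a rfl b rfl
        exact ⟨_, rfl, specLE_refl _, specLE_refl _⟩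
      obtain ⟨_, rfl, hy⟩ := hU {y} ⟨singleton_nonempty y, hdir⟩ x
        (fun V hV hxV => ⟨y, rfl, IsScott.isUpperSet_of_isOpen (D := univ) hV hxy hxV⟩) hx
      exact hy
    · refine hU D ⟨hne, ?_⟩ a (fun V hV haV => ?_) haU
      · simpa only [DirectedOn, specLE_iff] using hdir
      · exact (IsScott.isOpen_iff_isUpperSet_and_dirSupInaccOn (D := univ)).1 hV |>.2 trivial hne
          hdir ha haV

theorem IsDeflationaryDcpoSemilattice.isDeflationaryDirectedSemilattice {Q : Type u}
    [PartialOrder Q] [TopologicalSpace Q] [IsScott Q univ] {n : Q → Q → Q}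
    (h : IsDeflationaryDcpoSemilattice Q n) : IsDeflationaryDirectedSemilattice Q n where
  isDirectedSpace := isDirectedSpace_of_isScott Q
  continuous_left y := by
    rw [← IsScott.scottContinuousOn_iff_continuous (D := univ) fun _ _ _ => trivial,
      scottContinuousOn_univ]
    exact (ScottContinuous.id.prodMk (.const y)).comp h.scottContinuous
  continuous_right x := by
    rw [← IsScott.scottContinuousOn_iff_continuous (D := univ) fun _ _ _ => trivial,
      scottContinuousOn_univ]
    exact ((ScottContinuous.const x).prodMk .id).comp h.scottContinuous
  comm := h.comm
  assoc := h.assoc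
  idem := h.idem
  deflation x y := by
    rw [SpecLE, IsScott.closure_singleton]
    exact h.deflation x y

/-! ### The extended operation and the extension of maps. -/

namespace DCompletion

variable {Y : Type u} [TopologicalSpace Y]

section Meet

variable {n : Y → Y → Y} {m : DCompletion Y → DCompletion Y → DCompletion Y}

theorem isDeflationaryDcpoSemilattice (hn : IsDeflationaryDirectedSemilattice Y n)
    (hm : ∀ A B, (m A B).carrier = closure (image2 n A.carrier B.carrier)) :
    IsDeflationaryDcpoSemilattice (DCompletion Y) m := by
  have comm : ∀ A B, m A B = m B A := fun A B => carrier_injective (by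
    rw [hm, hm, image2_swap]
    simp only [hn.comm])
  have left : ∀ B, ScottContinuous fun A => m A B := fun B S hne hS A hA => by
    refine isLUB_of_carrier_eq ?_
    rw [hm, (isLUB_iff hne hS).1 hA, closure_image2_closure_left hn.continuous_left,
      image2_iUnion₂_left, biUnion_image, iUnion₂_congr fun B _ => hm B _,
      closure_biUnion_closure]
  -- For Scott continuity, continuity in each variable gives joint continuity.
  refine ⟨isDcpo, .fromProd (fun A => ?_) left, comm, fun A B C => carrier_injective ?_,
    fun A => carrier_injective ?_, fun A B => ?_⟩
  · simpa only [comm A] using left A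
  · rw [hm, hm, hm, hm, closure_image2_closure_left hn.continuous_left,
      closure_image2_closure_right hn.continuous_right, image2_assoc hn.assoc]
  · rw [hm]
    refine Subset.antisymm (closure_minimal ?_ A.isClosed_carrier)
      fun a ha => subset_closure ⟨a, ha, a, ha, hn.idem a⟩
    rintro _ ⟨a, ha, b, -, rfl⟩
    exact (hn.deflation a b).mem_of_isClosed A.isClosed_carrier ha
  · change (m A B).carrier ⊆ A.carrier
    rw [hm]
    refine closure_minimal ?_ A.isClosed_carrier
    rintro _ ⟨a, ha, b, -, rfl⟩
    exact (hn.deflation a b).mem_of_isClosed A.isClosed_carrier ha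

theorem map_xi (hn : IsDeflationaryDirectedSemilattice Y n)
    (hm : ∀ A B, (m A B).carrier = closure (image2 n A.carrier B.carrier)) (x y : Y) :
    m (xi x) (xi y) = xi (n x y) := carrier_injective (by
  rw [hm, xi_carrier, xi_carrier, closure_image2_closure_left hn.continuous_left,
    closure_image2_closure_right hn.continuous_right, image2_singleton, xi_carrier])

end Meet

theorem exists_scottContinuous_extension {Q : Type v} [PartialOrder Q] [TopologicalSpace Q]
    [IsScott Q univ] (hQ : IsDcpo Q) {g : Y → Q} (hg : Continuous g) :
    ∃ h : DCompletion Y → Q, ScottContinuous h ∧ ∀ y, h (xi y) = g y := by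
  -- Closure adds no new constraint on upper bounds, since `g ⁻¹' Iic c` is closed. Suprema over `A`
  -- can thus be computed before taking the closure.
  have upper : ∀ (T : Set Y) (c : Q), c ∈ upperBounds (g '' closure T) ↔ ∀ y ∈ T, g y ≤ c := by
    intro T c
    refine ⟨fun h y hy => h (mem_image_of_mem g (subset_closure hy)), ?_⟩
    rintro h _ ⟨y, hy, rfl⟩
    exact closure_minimal (t := g ⁻¹' Iic c) h (isClosed_Iic.preimage hg) hy
  have hex : ∀ A : DCompletion Y, ∃ b, IsLUB (g '' A.carrier) b := by
    intro A
    induction A using DCompletion.induction with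
    | xi y =>
      refine ⟨g y, (upper _ _).2 (by simp), fun c hc => (upper _ _).1 hc y rfl⟩
    | sup S A hne hS hA ih =>
      have : Nonempty Q := A.nonempty_carrier.to_type.map fun y => g y
      choose! b hb using ih
      obtain ⟨c, hc⟩ := hQ (b '' S) (hne.image b) (by
        rintro _ ⟨B, hB, rfl⟩ _ ⟨C, hC, rfl⟩
        obtain ⟨E, hE, h₁, h₂⟩ := hS B hB C hC
        exact ⟨_, mem_image_of_mem b hE, (hb B hB).mono (hb E hE) (image_mono h₁),
          (hb C hC).mono (hb E hE) (image_mono h₂)⟩)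
      refine ⟨c, ?_⟩
      rw [(isLUB_iff hne hS).1 hA]
      refine ⟨(upper _ _).2 fun y hy => ?_, fun d hd => hc.2 ?_⟩
      · obtain ⟨B, hB, hyB⟩ := mem_iUnion₂.1 hy
        exact ((hb B hB).1 (mem_image_of_mem g hyB)).trans (hc.1 (mem_image_of_mem b hB))
      · rintro _ ⟨B, hB, rfl⟩
        refine (hb B hB).2 ?_
        rintro _ ⟨y, hy, rfl⟩
        exact (upper _ _).1 hd y (mem_iUnion₂.2 ⟨B, hB, hy⟩)
  choose h hh using hex
  refine ⟨h, fun S hne hS A hA => ⟨?_, fun c hc => (hh A).2 ?_⟩, fun y => (hh _).unique ?_⟩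
  · rintro _ ⟨B, hB, rfl⟩
    exact (hh B).mono (hh A) (image_mono (hA.1 hB))
  · rw [(isLUB_iff hne hS).1 hA, upper]
    intro y hy
    obtain ⟨B, hB, hyB⟩ := mem_iUnion₂.1 hy
    exact ((hh B).1 (mem_image_of_mem g hyB)).trans (hc (mem_image_of_mem h hB))
  · exact ⟨(upper _ _).2 (by simp), fun c hc => (upper _ _).1 hc y rfl⟩

end DCompletion

/-! ### The upper powerdomain and its uniqueness. -/

theorem isUpperPowerdomain_dCompletion (L : Type u) [PartialOrder L]
    {m : DCompletion (UpperSpace (WithScott L)) → DCompletion (UpperSpace (WithScott L)) →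
      DCompletion (UpperSpace (WithScott L))}
    (hm : ∀ A B, (m A B).carrier = closure (image2 UpperSpace.union A.carrier B.carrier)) :
    IsUpperPowerdomain.{u, v, u} L (DCompletion (UpperSpace (WithScott L))) m
      (fun x => DCompletion.xi (UpperSpace.unit (WithScott.toScott x))) := by
  have hL : IsDirectedSpace (WithScott L) := @isDirectedSpace_of_isScott (WithScott L) ‹_› _ ⟨rfl⟩
  have hU := UpperSpace.isDeflationaryDirectedSemilattice (X := WithScott L)
  have alg := DCompletion.isDeflationaryDcpoSemilattice hU hm
  have map_xi := DCompletion.map_xi hU hm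
  let _ : TopologicalSpace (DCompletion (UpperSpace (WithScott L))) := DCompletion.topology _
  have : IsScott (DCompletion (UpperSpace (WithScott L))) univ :=
    ⟨DCompletion.topology_eq_scott UpperSpace.isDirectedSpace⟩
  have hunit : Continuous fun x : WithScott L => DCompletion.xi (UpperSpace.unit x) :=
    DCompletion.continuous_xi.comp (UpperSpace.continuous_unit hL)
  refine ⟨alg, ?_, fun Q _ n hQ f hf => ?_⟩
  · rw [← IsScott.scottContinuousOn_iff_continuous (D := univ) fun _ _ _ => trivial,
      scottContinuousOn_univ] at hunit
    exact hunit
  · let _ : TopologicalSpace Q := scott Q univ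
    have : IsScott Q univ := ⟨rfl⟩
    have hf' : Continuous fun x : WithScott L => f (WithScott.ofScott x) := by
      rw [← IsScott.scottContinuousOn_iff_continuous (D := univ) fun _ _ _ => trivial,
        scottContinuousOn_univ]
      exact hf
    obtain ⟨g, ⟨hg, hgmap, hgf⟩, hguniq⟩ :=
      (isDirectedUpperPowerspace_upperSpace hL).existsUnique_lift Q n hQ.isDeflationaryDirectedSemilattice _ hf'
    obtain ⟨h, hh, hhg⟩ := DCompletion.exists_scottContinuous_extension hQ.isDcpo hg
    refine ⟨h, ⟨hh, fun A B => ?_, fun x => (hhg _).trans (hgf _)⟩, ?_⟩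
    · have mcomp : ∀ {k₁ k₂ : DCompletion (UpperSpace (WithScott L)) →
          DCompletion (UpperSpace (WithScott L))}, ScottContinuous k₁ → ScottContinuous k₂ →
          ScottContinuous fun A => h (m (k₁ A) (k₂ A)) := fun h₁ h₂ =>
        ((h₁.prodMk h₂).comp alg.scottContinuous).comp hh
      have ncomp : ∀ {k₁ k₂ : DCompletion (UpperSpace (WithScott L)) → Q}, ScottContinuous k₁ →
          ScottContinuous k₂ → ScottContinuous fun A => n (k₁ A) (k₂ A) := fun h₁ h₂ =>
        (h₁.prodMk h₂).comp hQ.scottContinuous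
      -- The homomorphism law holds on `ξ × ξ` and is extended one variable at a time.
      have step : ∀ y, h (m A (DCompletion.xi y)) = n (h A) (h (DCompletion.xi y)) := fun y =>
        congrFun (DCompletion.ext_of_scottContinuous (mcomp .id (.const (DCompletion.xi y)))
          (ncomp hh (.const (h (DCompletion.xi y)))) fun x => by
            simp only [id, Function.const, map_xi, hhg, hgmap]) A
      exact congrFun (DCompletion.ext_of_scottContinuous (mcomp (.const A) .id)
        (ncomp (.const (h A)) hh) step) B
    · rintro h' ⟨hh', hmap', hf'⟩
      refine DCompletion.ext_of_scottContinuous hh' hh fun y => ?_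
      rw [← scottContinuousOn_univ,
        IsScott.scottContinuousOn_iff_continuous (D := univ) fun _ _ _ => trivial] at hh'
      rw [hhg, ← hguniq (fun y => h' (DCompletion.xi y))
        ⟨hh'.comp DCompletion.continuous_xi, fun a b =>
          (congrArg h' (map_xi a b).symm).trans (hmap' _ _), hf'⟩]

theorem IsUpperPowerdomain.existsUnique_orderIso {L : Type u} [PartialOrder L] {P Q : Type v}
    [PartialOrder P] [PartialOrder Q] {m : P → P → P} {n : Q → Q → Q} {i : L → P} {j : L → Q}
    (hP : IsUpperPowerdomain.{u, v, v} L P m i) (hQ : IsUpperPowerdomain.{u, v, v} L Q n j) :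
    ∃! e : P ≃o Q, (∀ A B, e (m A B) = n (e A) (e B)) ∧ ∀ x, e (i x) = j x := by
  obtain ⟨f, ⟨hf, hfm, hfi⟩, hfu⟩ := hP.existsUnique_lift Q n hQ.isAlgebra j hQ.unit_scottContinuous
  obtain ⟨g, ⟨hg, hgm, hgi⟩, -⟩ := hQ.existsUnique_lift P m hP.isAlgebra i hP.unit_scottContinuous
  have hgf : g ∘ f = id :=
    (hP.existsUnique_lift P m hP.isAlgebra i hP.unit_scottContinuous).unique
      ⟨hf.comp hg, fun a b => by simp [hfm, hgm], fun x => by simp [hfi, hgi]⟩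
      ⟨.id, fun _ _ => rfl, fun _ => rfl⟩
  have hfg : f ∘ g = id :=
    (hQ.existsUnique_lift Q n hQ.isAlgebra j hQ.unit_scottContinuous).unique
      ⟨hg.comp hf, fun a b => by simp [hfm, hgm], fun x => by simp [hfi, hgi]⟩
      ⟨.id, fun _ _ => rfl, fun _ => rfl⟩
  let e : P ≃ Q := ⟨f, g, congrFun hgf, congrFun hfg⟩
  refine ⟨e.toOrderIso hf.monotone hg.monotone, ⟨hfm, hfi⟩, fun e' he' => ?_⟩
  refine DFunLike.coe_injective (hfu e' ⟨?_, he'⟩)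
  -- An order isomorphism preserves all suprema, so it is Scott continuous and uniqueness of the
  -- lift applies.
  exact fun _ _ _ _ ha => e'.isLUB_image'.2 ha

end DirectedPowerspace

open DirectedPowerspace
theorem mainTheorem6 (L : Type u) [PartialOrder L] (hL : IsDcpo L) :
    -- `UΣL` with the convergence topology and union is the directed upper powerspace of `ΣL`
    IsDirectedUpperPowerspace.{u, v, u} (WithScott L) (UpperSpace (WithScott L))
      UpperSpace.union UpperSpace.unit ∧
    -- the topology of its D-completion is the Scott topology of the inclusion order
    DCompletion.topology (UpperSpace (WithScott L)) =
      Topology.scott (DCompletion (UpperSpace (WithScott L))) univ ∧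
    -- its D-completion, with the extended operation, is the upper powerdomain of `L`
    ∃ m : DCompletion (UpperSpace (WithScott L)) → DCompletion (UpperSpace (WithScott L)) →
        DCompletion (UpperSpace (WithScott L)),
      (∀ A B, (m A B).carrier = closure (image2 UpperSpace.union A.carrier B.carrier)) ∧
      IsUpperPowerdomain.{u, v, u} L (DCompletion (UpperSpace (WithScott L))) m
        (fun x => DCompletion.xi (UpperSpace.unit (WithScott.toScott x))) ∧
      -- and every upper powerdomain of `L` is isomorphic to it, by a unique isomorphism
      ∀ (P : Type u) [PartialOrder P] (n : P → P → P) (j : L → P),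
        IsUpperPowerdomain.{u, u, u} L P n j →
          ∃! e : DCompletion (UpperSpace (WithScott L)) ≃o P,
            (∀ A B, e (m A B) = n (e A) (e B)) ∧
            ∀ x, e (DCompletion.xi (UpperSpace.unit (WithScott.toScott x))) = j x := by
  have hU := UpperSpace.isDeflationaryDirectedSemilattice (X := WithScott L)
  choose m hm using DCompletion.exists_carrier_eq_closure_image2 hU.continuous_left
    hU.continuous_right
  exact ⟨isDirectedUpperPowerspace_upperSpace
      (@isDirectedSpace_of_isScott (WithScott L) ‹_› _ ⟨rfl⟩),
    DCompletion.topology_eq_scott UpperSpace.isDirectedSpace, m, hm,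
    isUpperPowerdomain_dCompletion L hm,
    fun P _ n j hP => (isUpperPowerdomain_dCompletion L hm).existsUnique_orderIso hP⟩
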